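/- Let $D=(V,A)$ be a finite digraph (parallel edges and loops are allowed), let $f:A\to\mathbb Z\cup\{-\infty\}$ and $g:A\to\mathbb Z\cup\{+\infty\}$ be bounds with $f\le g$, let $m:V\to\mathbb Z$ satisfy $\sum_{v\in V}m(v)=0$, and let $F\subseteq A$ be a set of edges on which both $f$ and $g$ are finite. An integral feasible $m$-flow is a $z\in\mathbb Z^A$ with $f\le z\le g$ such that, for every node $v$, the sum of $z$ over the edges entering $v$ minus the sum of $z$ over the edges leaving $v$ is $m(v)$; let $Q$ be the set of these. For $x,y\in\mathbb Z^A$, $x$ is decreasingly smaller than $y$ on $F$ if the components of $x$ on $F$, listed in decreasing order, form a lexicographically smaller vector than those of $y$; $z\in Q$ is decreasingly minimal (dec-min) on $F$ if no element of $Q$ is decreasingly smaller than $z$ on $F$. Let $z\in Q$. The auxiliary digraph $D_z=(V,A_z)$ has a forward edge $uv$ for each $uv\in A$ with $z(uv)<g(uv)$ and a backward edge $vu$ for each $uv\in A$ with $z(uv)>f(uv)$. For a di-circuit $C$ of $D_z$, let $z'$ be obtained from $z$ by adding $1$ on each edge of $D$ whose forward copy is in $C$ and subtracting $1$ on each edge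 of $D$ whose backward copy is in $C$; $C$ is $z$-improving (on $F$) if $z'\in Q$ and $z'$ is decreasingly smaller than $z$ on $F$. Let $F_z\subseteq A_z$ be the set of forward and backward edges of $D_z$ that come from edges in $F$. On $F_z$ define $z^*(uv)=z(uv)$ if $uv$ is forward, and $z^*(uv)=z(vu)-1$ if $uv$ is backward. Let $\gamma_1>\gamma_2>\dots>\gamma_k$ be the distinct values of $z^*$, and let $\varepsilon_i\in\mathbb Z^k$ be the $i$-th unit vector. Define $c:A_z\to\mathbb Z^k$ by $c(e)=0$ if $e\notin F_z$, $c(e)=\varepsilon_i$ if $e\in F_z$ is forward with $z^*(e)=\gamma_i$, and $c(e)=-\varepsilon_i$ if $e\in F_z$ is backward with $z^*(e)=\gamma_i$. Let $\preceq$ be the lexicographic order on $\mathbb Z^k$. Theorem. For every $z\in Q$, the following are equivalent. (A) $z$ is decreasingly minimal on $F$. (B) There is no $z$-improving di-circuit in $D_z$. (C) There is an integer-valued potential-vector function $\pi:V\to\mathbb Z^k$, of dimension $k\le 2|F|$, that is $c$-feasible, that is, $\pi(v)-\pi(u)\preceq c(uv)$ for every edge $uv\in A_z$. -/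

import Mathlib

/-- Data of a modular flow problem on a finite digraph with node-set `V` and edge-set `A`; parallel
edges and loops are allowed. The edge `e` goes from `tail e` to `head e`. The bounds are
integer-valued, where `lower e` may be `-∞` and `upper e` may be `+∞`. -/
structure ModFlowData (V A : Type*) where
  tail : A → V
  head : A → V
  lower : A → WithBot ℤ
  upper : A → WithTop ℤ
  m : V → ℤ

namespace ModFlowData

variable {V A : Type*} [Fintype A] (N : ModFlowData V A)

open Classical in
/-- `z` is an `m`-flow: at every node, the inflow minus the outflow is `m v`. -/
def IsMFlow (z : A → ℤ) : Prop :=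
  ∀ v : V, (∑ e with N.head e = v, z e) - (∑ e with N.tail e = v, z e) = N.m v

/-- The set of integral feasible (that is, `(lower, upper)`-bounded) `m`-flows. -/
def feasibleFlows : Set (A → ℤ) :=
  {z | N.IsMFlow z ∧ ∀ e, N.lower e ≤ (z e : WithBot ℤ) ∧ (z e : WithTop ℤ) ≤ N.upper e}

end ModFlowData

/-- The components of `x` on `F`, listed in decreasing order. -/
def decList {A : Type*} (F : Finset A) (x : A → ℤ) : List ℤ :=
  (F.val.map x).sort (· ≥ ·)

/-- `x` is decreasingly smaller than `y` on `F`: the components on `F`, listed in decreasing order,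
are lexicographically smaller. -/
def DecSmaller {A : Type*} (F : Finset A) (x y : A → ℤ) : Prop :=
  decList F x < decList F y

namespace ModFlowData

variable {V A : Type*} [Fintype A] (N : ModFlowData V A)

/-- `z` is a decreasingly minimal element, on `F`, of the set of integral feasible `m`-flows. -/
def IsDecMin (F : Finset A) (z : A → ℤ) : Prop :=
  z ∈ N.feasibleFlows ∧ ∀ y ∈ N.feasibleFlows, ¬ DecSmaller F y z

/-! The auxiliary digraph `D_z` on the node-set `V`. Its edges are among the elements of `A ⊕ A`:
`Sum.inl e` is the forward copy of `e`, and `Sum.inr e` is the backward (reversed) copy of `e`. -/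

/-- The edge of `D` from which an edge of the auxiliary digraph originates. -/
def base {A : Type*} : A ⊕ A → A := Sum.elim id id

def auxTail {V A : Type*} (N : ModFlowData V A) : A ⊕ A → V := Sum.elim N.tail N.head

def auxHead {V A : Type*} (N : ModFlowData V A) : A ⊕ A → V := Sum.elim N.head N.tail

open Classical in
/-- The edge-set `A_z` of the auxiliary digraph: forward copies of the edges with `z e < upper e`
and backward copies of the edges with `lower e < z e`. -/
noncomputable def auxEdges (z : A → ℤ) : Finset (A ⊕ A) :=
  Finset.univ.filter (Sum.elim (fun e => (z e : WithTop ℤ) < N.upper e)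
    (fun e => N.lower e < (z e : WithBot ℤ)))

/-- A di-circuit of the auxiliary digraph `D_z`, with edges `edge 0, …, edge n` in cyclic order
(so `i + 1` is computed modulo `n + 1`) and pairwise distinct nodes. -/
structure AuxDiCircuit (z : A → ℤ) where
  n : ℕ
  edge : Fin (n + 1) → A ⊕ A
  edge_mem : ∀ i, edge i ∈ N.auxEdges z
  head_eq_tail : ∀ i, N.auxHead (edge i) = N.auxTail (edge (i + 1))
  tail_injective : Function.Injective fun i => N.auxTail (edge i)

open Classical in
/-- The vector obtained from `z` by increasing it by `1` on the edges of `D` whose forward copy is in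
the di-circuit, and decreasing it by `1` on those whose backward copy is in the di-circuit. (If the
di-circuit consists of the two copies of one edge, the two changes cancel.) -/
noncomputable def AuxDiCircuit.augment {N : ModFlowData V A} {z : A → ℤ} (C : N.AuxDiCircuit z) :
    A → ℤ := fun e =>
  z e + (if Sum.inl e ∈ Set.range C.edge then 1 else 0)
    - (if Sum.inr e ∈ Set.range C.edge then 1 else 0)

/-- The di-circuit is `z`-improving on `F`. -/
def AuxDiCircuit.IsImproving {N : ModFlowData V A} {z : A → ℤ} (C : N.AuxDiCircuit z)
    (F : Finset A) : Prop :=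
  C.augment ∈ N.feasibleFlows ∧ DecSmaller F C.augment z

open Classical in
/-- `F_z`: the edges of the auxiliary digraph that correspond to edges in `F`. -/
noncomputable def auxF (F : Finset A) (z : A → ℤ) : Finset (A ⊕ A) :=
  (N.auxEdges z).filter fun a => base a ∈ F

/-- `z*`: equal to `z e` on the forward copy of `e` and to `z e - 1` on the backward copy. -/
def zStar {A : Type*} (z : A → ℤ) : A ⊕ A → ℤ := Sum.elim z fun e => z e - 1

/-- The set of distinct values of `z*` on `F_z`. -/
noncomputable def starValues (F : Finset A) (z : A → ℤ) : Finset ℤ :=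
  (N.auxF F z).image (zStar z)

/-- The number `k` of distinct values of `z*` on `F_z`: the dimension of the cost vectors. -/
noncomputable def costDim (F : Finset A) (z : A → ℤ) : ℕ := (N.starValues F z).card

/-- The distinct values `γ 0 > γ 1 > ⋯ > γ (k - 1)` of `z*` on `F_z`, in decreasing order. -/
noncomputable def gam (F : Finset A) (z : A → ℤ) (i : Fin (N.costDim F z)) : ℤ :=
  (N.starValues F z).orderEmbOfFin rfl i.rev

open Classical in
/-- The cost vector of an edge of the auxiliary digraph: `0` off `F_z`; for an edge of `F_z` with
`z* = γ i`, the `i`-th unit vector if the edge is forward and minus it if the edge is backward. -/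
noncomputable def cost (F : Finset A) (z : A → ℤ) (a : A ⊕ A) : Fin (N.costDim F z) → ℤ :=
  fun i =>
    if a ∈ N.auxF F z ∧ zStar z a = N.gam F z i then Sum.elim (fun _ => 1) (fun _ => -1) a else 0

/-- `π` is a potential-vector that is feasible for the cost vectors: `π v - π u ⪯ c(uv)` for every
edge `uv` of the auxiliary digraph, where `⪯` is the lexicographic order. -/
def IsFeasiblePotential (F : Finset A) (z : A → ℤ) (π : V → Fin (N.costDim F z) → ℤ) : Prop :=
  ∀ a ∈ N.auxEdges z, toLex (π (N.auxHead a) - π (N.auxTail a)) ≤ toLex (N.cost F z a)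

end ModFlowData

/-!
Decreasing minimality is turned into the minimization of the separable convex function
`x ↦ ∑ e ∈ F, B ^ x e`: once `B` exceeds `F.card`, this sum is strictly monotone for the
"decreasingly smaller" comparison (`DecSmaller.sum_zpow_lt`, `decSmaller_of_sum_zpow_lt`).
Similarly, if the unit vector `εᵢ` is priced at `B ^ (γᵢ + 1) - B ^ γᵢ`, then for large `B` (depending
on the vector) the price of an integer vector has its lexicographic sign
(`sum_mul_zpow_pos_of_lex_pos`). The price of the cost of an auxiliary edge coming from `e ∈ F` is the
change of `B ^ z e` caused by one unit of augmentation along it.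

A feasible potential makes the total cost of `y - z` lexicographically nonnegative for every feasible
flow `y`, because `y - z` is a circulation along edges of the auxiliary digraph. By convexity the
price of this cost bounds `∑ e ∈ F, (B ^ y e - B ^ z e)` from below, so `y` is not decreasingly smaller
than `z` (`ModFlowData.IsFeasiblePotential.not_decSmaller`).

Augmenting along a circuit of lexicographically negative cost keeps the flow feasible and lowers the
exponential sum, so such a circuit is improving
(`ModFlowData.AuxDiCircuit.isImproving_of_cost_neg`). If there is none, the lexicographically minimal
costs of simple paths form a feasible potential. This last step works for weights in any linearly
ordered abelian group (`exists_potential_of_circuits_nonneg`); taking the minimum in `ℤ ^ k` itself,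
not among priced values, is what makes the potential an integer vector.
-/

/-! ### Shortest paths in linearly ordered groups -/

section ShortestPaths

variable {V E G : Type*} (tl hd : E → V)

/-- `p` is a directed walk ending at `v`, listed backwards: the first entry of `p` is the last edge
of the walk. -/
def IsWalkTo (S : Finset E) : V → List E → Prop
  | _, [] => True
  | v, a :: p => a ∈ S ∧ hd a = v ∧ IsWalkTo S (tl a) p

variable {tl hd} {S : Finset E}

theorem IsWalkTo.mem {v : V} {p : List E} (h : IsWalkTo tl hd S v p) : ∀ a ∈ p, a ∈ S := by
  induction p generalizing v with
  | nil => simp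
  | cons b p ih =>
    intro a ha
    rcases List.mem_cons.1 ha with rfl | ha
    · exact h.1
    · exact ih h.2.2 a ha

/-- Cutting a walk at the tail of one of its edges. -/
theorem IsWalkTo.of_append {v : V} {q r : List E} {a : E}
    (h : IsWalkTo tl hd S v (q ++ a :: r)) :
    IsWalkTo tl hd S v (q ++ [a]) ∧ IsWalkTo tl hd S (tl a) r := by
  induction q generalizing v with
  | nil => exact ⟨⟨h.1, h.2.1, trivial⟩, h.2.2⟩
  | cons b q ih =>
    obtain ⟨h1, h2⟩ := ih h.2.2
    exact ⟨⟨h.1, h.2.1, h1⟩, h2⟩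

theorem IsWalkTo.hd_getElem_zero {v : V} {p : List E} (h : IsWalkTo tl hd S v p)
    (hp : 0 < p.length) : hd p[0] = v := by
  cases p with
  | nil => simp at hp
  | cons a p => exact h.2.1

theorem IsWalkTo.hd_getElem_succ {v : V} {p : List E} (h : IsWalkTo tl hd S v p) (j : ℕ)
    (hj : j + 1 < p.length) : hd p[j + 1] = tl p[j] := by
  induction p generalizing v j with
  | nil => simp at hj
  | cons a p ih =>
    cases j with
    | zero =>
      have hp : 0 < p.length := by simpa using hj
      simpa using h.2.2.hd_getElem_zero hp
    | succ j => simpa using ih h.2.2 j (by simpa using hj)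

variable [AddCommGroup G]

/-- If every circuit with edges in `S` has nonnegative weight, so does every closed walk that is
given as a list and repeats no node. -/
theorem IsWalkTo.sum_nonneg [LinearOrder G] {w : E → G}
    (hw : ∀ (n : ℕ) (c : Fin (n + 1) → E), (∀ i, c i ∈ S) → (∀ i, hd (c i) = tl (c (i + 1))) →
      (Function.Injective fun i => tl (c i)) → 0 ≤ ∑ i, w (c i))
    {v : V} {q : List E} {a : E} (h : IsWalkTo tl hd S v (q ++ [a])) (ha : tl a = v)
    (hnd : ((q ++ [a]).map tl).Nodup) : 0 ≤ ((q ++ [a]).map w).sum := by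
  set L := q ++ [a] with hL
  have hlen : L.length = q.length + 1 := by simp [hL]
  -- Walks are listed backwards, so the circuit reads the list from its end.
  let c : Fin (q.length + 1) → E := fun i => L[(i.rev : ℕ)]'(by have := i.rev.2; omega)
  have key := hw q.length c (fun i => h.mem _ (List.getElem_mem _)) ?_ ?_
  · have hs : ∑ i, w (c i) = (L.map w).sum := by
      rw [← List.sum_ofFn, ← List.sum_reverse]
      congr 1
      apply List.ext_getElem
      · simp [hlen]
      · intro i h1 h2
        simp only [List.length_reverse, List.length_ofFn] at h1
        simp only [List.getElem_reverse, List.getElem_ofFn, List.getElem_map, List.length_ofFn, c]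
        congr 2
        simp [Fin.rev]
        omega
    rwa [hs] at key
  · intro i
    refine Fin.lastCases ?_ (fun i => ?_) i
    · have h0 := h.hd_getElem_zero (by omega)
      simp only [c, Fin.last_add_one, Fin.rev_zero, Fin.rev_last, Fin.val_zero, Fin.val_last, h0]
      simp [hL, ha]
    · have h0 := h.hd_getElem_succ (q.length - (i + 1)) (by have := i.2; omega)
      have e1 : ((i.castSucc).rev : ℕ) = q.length - (i + 1) + 1 := by
        have := i.2
        simp [Fin.rev]; omega
      have e2 : ((i.castSucc + 1).rev : ℕ) = q.length - (i + 1) := by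
        rw [Fin.coeSucc_eq_succ]
        simp [Fin.rev]
      simp only [c, e1, e2, h0]
  · intro i j hij
    have := (List.nodup_iff_injective_getElem.1 hnd)
      (a₁ := ⟨i.rev, by have := i.rev.2; simp only [List.length_map]; omega⟩)
      (a₂ := ⟨j.rev, by have := j.rev.2; simp only [List.length_map]; omega⟩)
      (by simpa [c] using hij)
    exact Fin.rev_injective (Fin.ext (by simpa using this))

variable [LinearOrder G] [IsOrderedAddMonoid G]

/-- Conservative weights with values in a linearly ordered group admit a feasible potential: the
minimum weight of a simple path ending at a given node. -/
theorem exists_potential_of_circuits_nonneg [Finite E] (w : E → G)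
    (hw : ∀ (n : ℕ) (c : Fin (n + 1) → E), (∀ i, c i ∈ S) → (∀ i, hd (c i) = tl (c (i + 1))) →
      (Function.Injective fun i => tl (c i)) → 0 ≤ ∑ i, w (c i)) :
    ∃ π : V → G, ∀ a ∈ S, π (hd a) - π (tl a) ≤ w a := by
  classical
  let P : V → Set (List E) := fun v => {p | IsWalkTo tl hd S v p ∧ (v :: p.map tl).Nodup}
  have hfin : ∀ v, (P v).Finite := by
    intro v
    have := Fintype.ofFinite E
    refine (List.finite_length_le E (Fintype.card E)).subset fun p hp => ?_
    exact (List.Nodup.of_map tl (List.nodup_cons.1 hp.2).2).length_le_card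
  have hmin : ∀ v, ∃ p ∈ P v, ∀ q ∈ P v, (p.map w).sum ≤ (q.map w).sum := fun v =>
    Set.exists_min_image (P v) (fun p => (p.map w).sum) (hfin v) ⟨[], trivial, by simp⟩
  choose p hp hpmin using hmin
  refine ⟨fun v => ((p v).map w).sum, fun e he => ?_⟩
  rw [sub_le_iff_le_add]
  have hL : IsWalkTo tl hd S (hd e) (e :: p (tl e)) := ⟨he, rfl, (hp (tl e)).1⟩
  have hnd : ((e :: p (tl e)).map tl).Nodup := (hp (tl e)).2
  rw [← List.sum_cons, ← List.map_cons]
  by_cases hv : hd e ∈ (e :: p (tl e)).map tl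
  · -- The extended walk closes a circuit; removing it leaves a simple path to the same node.
    obtain ⟨a, ha, hae⟩ := List.mem_map.1 hv
    obtain ⟨q, r, hqr⟩ := List.append_of_mem ha
    rw [hqr] at hL hnd ⊢
    obtain ⟨h1, h2⟩ := hL.of_append
    have hr : r ∈ P (hd e) := by
      refine ⟨hae ▸ h2, ?_⟩
      rw [← hae]
      rw [List.map_append] at hnd
      exact hnd.of_append_right
    have h3 := h1.sum_nonneg hw hae (hnd.sublist (by simp))
    have h4 := hpmin _ r hr
    calc ((p (hd e)).map w).sum ≤ (r.map w).sum := h4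
      _ ≤ ((q ++ [a]).map w).sum + (r.map w).sum := le_add_of_nonneg_left h3
      _ = _ := by simp [add_assoc]
  · exact hpmin _ _ ⟨hL, List.nodup_cons.2 ⟨hv, hnd⟩⟩

end ShortestPaths

/-! ### Exponential sums and lexicographic comparison -/

/-- At the first place where the lists differ, the larger entry of `l₂` outweighs the whole rest of
`l₁`, since `B` exceeds the length of `l₁`. -/
theorem List.sum_zpow_lt_of_lt {B : ℚ} (l₁ l₂ : List ℤ) (hs : l₁.Pairwise (· ≥ ·))
    (hB : (l₁.length : ℚ) < B) (hB0 : 0 < B) (h : l₁ < l₂) :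
    (l₁.map (B ^ ·)).sum < (l₂.map (B ^ ·)).sum := by
  have hnn : ∀ l : List ℤ, 0 ≤ (l.map (B ^ ·)).sum := fun l =>
    List.sum_nonneg (by
      intro x hx
      obtain ⟨t, -, rfl⟩ := List.mem_map.1 hx
      positivity)
  induction l₁ generalizing l₂ with
  | nil =>
    cases l₂ with
    | nil => exact absurd h (lt_irrefl _)
    | cons b t =>
      have := hnn t
      have : 0 < B ^ b := by positivity
      simp only [List.map_nil, List.sum_nil, List.map_cons, List.sum_cons]
      linarith
  | cons a t ih =>
    cases l₂ with
    | nil => exact absurd h (by simp)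
    | cons b t₂ =>
      rw [List.pairwise_cons] at hs
      have hB1 : 1 < B := by
        refine lt_of_le_of_lt ?_ hB
        simp
      rcases List.cons_lt_cons_iff.1 h with hab | ⟨rfl, hlt⟩
      · have h1 : ((a :: t).map (B ^ ·)).sum ≤ (a :: t).length • B ^ a := by
          have := List.sum_le_card_nsmul ((a :: t).map (B ^ ·)) (B ^ a) (by
            intro x hx
            obtain ⟨s, hs', rfl⟩ := List.mem_map.1 hx
            refine zpow_le_zpow_right₀ hB1.le ?_
            rcases List.mem_cons.1 hs' with rfl | hs'
            · exact le_rfl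
            · exact hs.1 s hs')
          simpa using this
        have h2 : (a :: t).length • B ^ a < B * B ^ a := by
          rw [nsmul_eq_mul]
          exact mul_lt_mul_of_pos_right hB (by positivity)
        have h3 : B * B ^ a ≤ B ^ b := by
          rw [← zpow_one_add₀ hB0.ne']
          exact zpow_le_zpow_right₀ hB1.le (by omega)
        have h4 := hnn t₂
        rw [List.map_cons (l := t₂), List.sum_cons]
        linarith
      · have := ih t₂ hs.2 (by
          refine lt_trans ?_ hB
          simp) hlt
        simpa using this

theorem sum_zpow_eq_sum_decList {A : Type*} (F : Finset A) (x : A → ℤ) (B : ℚ) :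
    ∑ e ∈ F, B ^ x e = ((decList F x).map (B ^ ·)).sum := by
  rw [← Multiset.sum_coe, ← Multiset.map_coe, decList, Multiset.sort_eq, Multiset.map_map]
  rfl

theorem DecSmaller.sum_zpow_lt {A : Type*} {F : Finset A} {x y : A → ℤ} (h : DecSmaller F x y)
    {B : ℚ} (hB : (F.card : ℚ) < B) : ∑ e ∈ F, B ^ x e < ∑ e ∈ F, B ^ y e := by
  rw [sum_zpow_eq_sum_decList, sum_zpow_eq_sum_decList]
  refine List.sum_zpow_lt_of_lt _ _ ?_ ?_ (lt_of_le_of_lt (by positivity) hB) h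
  · exact Multiset.pairwise_sort _ _
  · simpa [decList] using hB

theorem decSmaller_of_sum_zpow_lt {A : Type*} {F : Finset A} {x y : A → ℤ} {B : ℚ}
    (hB : (F.card : ℚ) < B) (h : ∑ e ∈ F, B ^ x e < ∑ e ∈ F, B ^ y e) : DecSmaller F x y := by
  rcases lt_trichotomy (decList F x) (decList F y) with hlt | heq | hgt
  · exact hlt
  · have : ∑ e ∈ F, B ^ x e = ∑ e ∈ F, B ^ y e := by
      rw [sum_zpow_eq_sum_decList, sum_zpow_eq_sum_decList, heq]
    exact absurd h this.not_lt
  · exact absurd (DecSmaller.sum_zpow_lt hgt hB) h.not_gt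

/-- For a base exceeding the total size of the coefficients, the sign of an exponential sum with
decreasing exponents is decided by the first nonzero coefficient. -/
theorem sum_mul_zpow_pos_of_lex_pos {k : ℕ} {γ : Fin k → ℤ} (hγ : StrictAnti γ) {C : Fin k → ℤ}
    (hC : 0 < toLex C) {B : ℚ} (hB : ∑ i, |(C i : ℚ)| < B) : 0 < ∑ i, (C i : ℚ) * B ^ γ i := by
  obtain ⟨i, hlt, hi⟩ : ∃ i, (∀ j < i, 0 = C j) ∧ 0 < C i := hC
  have hi1 : (1 : ℚ) ≤ C i := by exact_mod_cast hi
  have hBi : |(C i : ℚ)| + ∑ j ∈ Finset.univ.erase i, |(C j : ℚ)| < B := by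
    rwa [Finset.add_sum_erase _ (fun j => |(C j : ℚ)|) (Finset.mem_univ i)]
  have hr : 0 ≤ ∑ j ∈ Finset.univ.erase i, |(C j : ℚ)| := Finset.sum_nonneg fun _ _ => abs_nonneg _
  have hB1 : 1 < B := by
    have := le_abs_self (C i : ℚ)
    linarith
  have hB0 : 0 < B := by linarith
  rw [← Finset.add_sum_erase _ _ (Finset.mem_univ i)]
  have hterm : ∀ j ∈ Finset.univ.erase i,
      -(|(C j : ℚ)| * B ^ (γ i - 1)) ≤ (C j : ℚ) * B ^ γ j := by
    intro j hj
    rcases lt_or_gt_of_ne (Finset.ne_of_mem_erase hj) with hji | hij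
    · have hj0 : C j = 0 := (hlt j hji).symm
      rw [hj0, Int.cast_zero, abs_zero, zero_mul, zero_mul, neg_zero]
    · have h1 : B ^ γ j ≤ B ^ (γ i - 1) :=
        zpow_le_zpow_right₀ hB1.le (by have := hγ hij; omega)
      have h2 : 0 < B ^ γ j := by positivity
      calc -(|(C j : ℚ)| * B ^ (γ i - 1)) ≤ -(|(C j : ℚ)| * B ^ γ j) :=
            neg_le_neg (mul_le_mul_of_nonneg_left h1 (abs_nonneg _))
        _ = -|(C j : ℚ)| * B ^ γ j := by ring
        _ ≤ _ := mul_le_mul_of_nonneg_right (neg_abs_le _) h2.le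
  have hsum := Finset.sum_le_sum hterm
  rw [Finset.sum_neg_distrib, ← Finset.sum_mul] at hsum
  have hpow : B ^ γ i = B * B ^ (γ i - 1) := by
    rw [← zpow_one_add₀ hB0.ne']
    congr 1
    ring
  have hq : 0 < B ^ (γ i - 1) := by positivity
  have h3 : (∑ j ∈ Finset.univ.erase i, |(C j : ℚ)|) * B ^ (γ i - 1) < B * B ^ (γ i - 1) :=
    mul_lt_mul_of_pos_right (by have := abs_nonneg (C i : ℚ); linarith) hq
  have h4 : B ^ γ i ≤ C i * B ^ γ i := le_mul_of_one_le_left (by positivity) hi1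
  linarith

theorem sum_mul_zpow_neg_of_lex_neg {k : ℕ} {γ : Fin k → ℤ} (hγ : StrictAnti γ) {C : Fin k → ℤ}
    (hC : toLex C < 0) {B : ℚ} (hB : ∑ i, |(C i : ℚ)| < B) : ∑ i, (C i : ℚ) * B ^ γ i < 0 := by
  have h := sum_mul_zpow_pos_of_lex_pos hγ (C := -C) (B := B) (neg_pos.2 hC) (by simpa using hB)
  simpa using h

theorem sum_mul_zpow_nonneg_of_lex_nonneg {k : ℕ} {γ : Fin k → ℤ} (hγ : StrictAnti γ)
    {C : Fin k → ℤ} (hC : 0 ≤ toLex C) {B : ℚ} (hB : ∑ i, |(C i : ℚ)| < B) :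
    0 ≤ ∑ i, (C i : ℚ) * B ^ γ i := by
  rcases hC.eq_or_lt with h0 | hpos
  · have : C = 0 := h0.symm
    simp [this]
  · exact (sum_mul_zpow_pos_of_lex_pos hγ hpos hB).le

/-- Convexity of `t ↦ B ^ t`: the first upward increment bounds every later one from below. -/
theorem natCast_mul_le_zpow_add_sub_zpow {B : ℚ} (hB : 1 ≤ B) (t : ℤ) (n : ℕ) :
    n * ((B - 1) * B ^ t) ≤ B ^ (t + n) - B ^ t := by
  have hB0 : 0 < B := by linarith
  have h := one_add_mul_le_pow (a := B - 1) (by linarith) n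
  have ht : 0 < B ^ t := by positivity
  rw [add_sub_cancel] at h
  rw [zpow_add₀ hB0.ne', zpow_natCast]
  nlinarith [mul_le_mul_of_nonneg_left h ht.le]

/-- Convexity of `t ↦ B ^ t`: the first downward step lowers the value at least as much as every
later one. -/
theorem natCast_mul_le_zpow_sub_sub_zpow {B : ℚ} (hB : 1 ≤ B) (t : ℤ) (n : ℕ) :
    n * (-((B - 1) * B ^ (t - 1))) ≤ B ^ (t - n) - B ^ t := by
  have hB0 : 0 < B := by linarith
  have h := one_add_mul_le_pow (a := B⁻¹ - 1)
    (by have : 0 < B⁻¹ := by positivity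
        linarith) n
  have ht : 0 < B ^ t := by positivity
  rw [add_sub_cancel] at h
  have e1 : (B - 1) * B ^ (t - 1) = (1 - B⁻¹) * B ^ t := by
    rw [zpow_sub_one₀ hB0.ne']
    field_simp
  have e2 : B ^ (t - n) = B ^ t * B⁻¹ ^ n := by
    rw [sub_eq_add_neg, zpow_add₀ hB0.ne', zpow_neg, zpow_natCast, inv_pow]
  rw [e1, e2]
  nlinarith [mul_le_mul_of_nonneg_left h ht.le]

/-! ### Costs in the auxiliary digraph -/

namespace ModFlowData

variable {V A : Type*} [Fintype A] {N : ModFlowData V A} {F : Finset A} {z : A → ℤ}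

theorem gam_strictAnti : StrictAnti (N.gam F z) := fun _ _ hij =>
  ((N.starValues F z).orderEmbOfFin rfl).strictMono (Fin.rev_lt_rev.2 hij)

theorem exists_gam_eq {a : A ⊕ A} (ha : a ∈ N.auxF F z) : ∃ i, N.gam F z i = zStar z a := by
  have hmem : zStar z a ∈ Set.range ((N.starValues F z).orderEmbOfFin rfl) := by
    rw [Finset.range_orderEmbOfFin]
    exact Finset.mem_coe.2 (Finset.mem_image_of_mem _ ha)
  obtain ⟨j, hj⟩ := hmem
  exact ⟨j.rev, (congrArg _ (Fin.rev_rev j)).trans hj⟩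

theorem mem_auxF {a : A ⊕ A} : a ∈ N.auxF F z ↔ a ∈ N.auxEdges z ∧ base a ∈ F := by
  simp [auxF]

theorem inl_mem_auxEdges {e : A} :
    Sum.inl e ∈ N.auxEdges z ↔ (z e : WithTop ℤ) < N.upper e := by
  simp [auxEdges]

theorem inr_mem_auxEdges {e : A} :
    Sum.inr e ∈ N.auxEdges z ↔ N.lower e < (z e : WithBot ℤ) := by
  simp [auxEdges]

theorem costDim_le : N.costDim F z ≤ 2 * F.card := by
  classical
  calc N.costDim F z ≤ (N.auxF F z).card := Finset.card_image_le
    _ ≤ (F.disjSum F).card := by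
        refine Finset.card_le_card fun a ha => ?_
        have hb := (mem_auxF.1 ha).2
        rcases a with e | e <;> simpa [base] using hb
    _ = 2 * F.card := by rw [Finset.card_disjSum, two_mul]

variable (N F z) in
/-- The value of a cost vector when the unit vector `εᵢ` is priced at the increment
`B ^ (γᵢ + 1) - B ^ γᵢ`. -/
noncomputable def price (B : ℚ) (c : Fin (N.costDim F z) → ℤ) : ℚ :=
  ∑ i, (c i : ℚ) * ((B - 1) * B ^ N.gam F z i)

theorem price_eq (B : ℚ) (c : Fin (N.costDim F z) → ℤ) :
    N.price F z B c = (B - 1) * ∑ i, (c i : ℚ) * B ^ N.gam F z i := by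
  rw [price, Finset.mul_sum]
  exact Finset.sum_congr rfl fun i _ => by ring

theorem price_sum (B : ℚ) {ι : Type*} (s : Finset ι) (c : ι → Fin (N.costDim F z) → ℤ) :
    N.price F z B (∑ j ∈ s, c j) = ∑ j ∈ s, N.price F z B (c j) := by
  simp only [price, Finset.sum_apply, Int.cast_sum, Finset.sum_mul]
  exact Finset.sum_comm

theorem price_nsmul (B : ℚ) (n : ℕ) (c : Fin (N.costDim F z) → ℤ) :
    N.price F z B (n • c) = n * N.price F z B c := by
  simp only [price, Finset.mul_sum]
  exact Finset.sum_congr rfl fun i _ => by simp [mul_assoc]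

theorem cost_of_base_notMem {a : A ⊕ A} (ha : base a ∉ F) : N.cost F z a = 0 := by
  funext i
  simp [cost, mem_auxF, ha]

theorem price_cost_of_base_notMem (B : ℚ) {a : A ⊕ A} (ha : base a ∉ F) :
    N.price F z B (N.cost F z a) = 0 := by
  simp [price, cost_of_base_notMem ha]

theorem price_cost (B : ℚ) {a : A ⊕ A} (ha : a ∈ N.auxF F z) :
    N.price F z B (N.cost F z a) =
      (Sum.elim (fun _ => 1) (fun _ => -1) a : ℤ) * ((B - 1) * B ^ zStar z a) := by
  obtain ⟨i, hi⟩ := exists_gam_eq ha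
  rw [price, Finset.sum_eq_single i]
  · simp [cost, ha, hi]
  · intro j _ hj
    have : zStar z a ≠ N.gam F z j := fun h => hj (gam_strictAnti.injective (by rw [hi, h]))
    simp [cost, this]
  · simp

theorem price_cost_inl (B : ℚ) {e : A} (he : Sum.inl e ∈ N.auxEdges z) (hF : e ∈ F) :
    N.price F z B (N.cost F z (Sum.inl e)) = (B - 1) * B ^ z e := by
  rw [price_cost B (mem_auxF.2 ⟨he, hF⟩)]
  simp [zStar]

theorem price_cost_inr (B : ℚ) {e : A} (he : Sum.inr e ∈ N.auxEdges z) (hF : e ∈ F) :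
    N.price F z B (N.cost F z (Sum.inr e)) = -((B - 1) * B ^ (z e - 1)) := by
  rw [price_cost B (mem_auxF.2 ⟨he, hF⟩)]
  simp [zStar]

/-! ### Feasible potentials certify decreasing minimality -/

/-- The difference of two `m`-flows is a circulation, so it is orthogonal to every potential
difference. -/
theorem IsMFlow.sum_sub_zsmul_eq_zero [Fintype V] {y : A → ℤ} (hy : N.IsMFlow y)
    (hz : N.IsMFlow z) {G : Type*} [AddCommGroup G] (p : V → G) :
    ∑ e, (y e - z e) • (p (N.head e) - p (N.tail e)) = 0 := by
  classical
  have hfib : ∀ g : A → V, ∑ e, (y e - z e) • p (g e) =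
      ∑ v, ((∑ e with g e = v, y e) - ∑ e with g e = v, z e) • p v := by
    intro g
    rw [← Finset.sum_fiberwise Finset.univ g]
    refine Finset.sum_congr rfl fun v _ => ?_
    rw [← Finset.sum_sub_distrib, Finset.sum_smul]
    refine Finset.sum_congr rfl fun e he => ?_
    rw [(Finset.mem_filter.1 he).2]
  simp only [smul_sub, Finset.sum_sub_distrib]
  rw [hfib, hfib, ← Finset.sum_sub_distrib]
  refine Finset.sum_eq_zero fun v _ => ?_
  rw [← sub_smul]
  have h1 := hy v
  have h2 := hz v
  have : ((∑ e with N.head e = v, y e) - ∑ e with N.head e = v, z e) -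
      ((∑ e with N.tail e = v, y e) - ∑ e with N.tail e = v, z e) = 0 := by
    convert sub_eq_zero.2 (h1.trans h2.symm) using 1
    ring_nf
  rw [this, zero_smul]

theorem IsFeasiblePotential.not_decSmaller [Fintype V] {π : V → Fin (N.costDim F z) → ℤ}
    (hπ : N.IsFeasiblePotential F z π) (hz : z ∈ N.feasibleFlows) {y : A → ℤ}
    (hy : y ∈ N.feasibleFlows) : ¬ DecSmaller F y z := by
  classical
  intro hlt
  -- The difference `y - z` is a sum of `n e` copies of the auxiliary edges `step e`.
  let step : A → A ⊕ A := fun e => if z e ≤ y e then Sum.inl e else Sum.inr e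
  let n : A → ℕ := fun e => (y e - z e).natAbs
  have hstep : ∀ e, n e ≠ 0 → step e ∈ N.auxEdges z := by
    intro e hne
    by_cases h : z e ≤ y e
    · have hlt' : z e < y e := by simp only [n] at hne; omega
      simp only [step, if_pos h]
      exact inl_mem_auxEdges.2 ((WithTop.coe_lt_coe.2 hlt').trans_le (hy.2 e).2)
    · simp only [step, if_neg h]
      exact inr_mem_auxEdges.2 ((hy.2 e).1.trans_lt (WithBot.coe_lt_coe.2 (not_le.1 h)))
  let p : V → Lex (Fin (N.costDim F z) → ℤ) := fun v => toLex (π v)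
  have hC : 0 ≤ ∑ e, n e • toLex (N.cost F z (step e)) := by
    rw [← hy.1.sum_sub_zsmul_eq_zero hz.1 p]
    refine Finset.sum_le_sum fun e _ => ?_
    by_cases hne : n e = 0
    · have : y e - z e = 0 := Int.natAbs_eq_zero.1 hne
      simp [hne, this]
    · have h1 := nsmul_le_nsmul_right (hπ _ (hstep e hne)) (n e)
      refine le_trans (le_of_eq ?_) h1
      change _ = n e • (p (N.auxHead (step e)) - p (N.auxTail (step e)))
      by_cases h : z e ≤ y e
      · have hn : ((n e : ℕ) : ℤ) = y e - z e := by simp only [n]; omega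
        rw [← hn, natCast_zsmul]
        simp [step, h, auxHead, auxTail]
      · have hn : -((n e : ℕ) : ℤ) = y e - z e := by simp only [n]; omega
        rw [← hn, neg_smul, natCast_zsmul, ← neg_nsmul, neg_sub]
        simp [step, h, auxHead, auxTail]
  let C : Fin (N.costDim F z) → ℤ := ∑ e, n e • N.cost F z (step e)
  have hC' : 0 ≤ toLex C := by
    have : toLex C = ∑ e, n e • toLex (N.cost F z (step e)) := rfl
    rwa [this]
  have hS : 0 ≤ ∑ i, |(C i : ℚ)| := Finset.sum_nonneg fun _ _ => abs_nonneg _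
  obtain ⟨B, hB⟩ : ∃ B : ℚ, B = F.card + (∑ i, |(C i : ℚ)|) + 1 := ⟨_, rfl⟩
  have hF0 : (0 : ℚ) ≤ F.card := by positivity
  have hpr : 0 ≤ N.price F z B C := by
    rw [price_eq]
    exact mul_nonneg (by linarith) (sum_mul_zpow_nonneg_of_lex_nonneg gam_strictAnti hC'
      (by linarith))
  have hle : N.price F z B C ≤ ∑ e ∈ F, (B ^ y e - B ^ z e) := by
    rw [price_sum, ← Finset.sum_subset F.subset_univ]
    · refine Finset.sum_le_sum fun e he => ?_
      rw [price_nsmul]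
      by_cases hne : n e = 0
      · have : y e = z e := sub_eq_zero.1 (Int.natAbs_eq_zero.1 hne)
        simp [hne, this]
      · have hmem := hstep e hne
        by_cases h : z e ≤ y e
        · have hs : step e = Sum.inl e := if_pos h
          rw [hs] at hmem ⊢
          rw [price_cost_inl B hmem he]
          have hy' : y e = z e + n e := by simp only [n]; omega
          rw [hy']
          exact natCast_mul_le_zpow_add_sub_zpow (by linarith) (z e) (n e)
        · have hs : step e = Sum.inr e := if_neg h
          rw [hs] at hmem ⊢
          rw [price_cost_inr B hmem he]
          have hy' : y e = z e - n e := by simp only [n]; omega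
          rw [hy']
          exact natCast_mul_le_zpow_sub_sub_zpow (by linarith) (z e) (n e)
    · intro e _ he
      have hb : base (step e) ∉ F := by
        simp only [step]
        split_ifs <;> exact he
      rw [price_nsmul, price_cost_of_base_notMem B hb, mul_zero]
  have := hlt.sum_zpow_lt (B := B) (by linarith)
  rw [Finset.sum_sub_distrib] at hle
  linarith

/-! ### Circuits of negative cost are improving -/

theorem sum_ite_mem_range {ι α M : Type*} [Fintype ι] [Fintype α] [AddCommMonoid M] {c : ι → α}
    (hc : Function.Injective c) [DecidablePred (· ∈ Set.range c)] (h : α → M) :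
    ∑ a, (if a ∈ Set.range c then h a else 0) = ∑ i, h (c i) := by
  classical
  rw [← Finset.sum_filter]
  have : Finset.univ.filter (· ∈ Set.range c) = Finset.univ.image c := by
    ext a
    simp
  rw [this, Finset.sum_image hc.injOn]

namespace AuxDiCircuit

variable (C : N.AuxDiCircuit z)

theorem edge_injective : Function.Injective C.edge := fun _ _ hij =>
  C.tail_injective (congrArg N.auxTail hij)

theorem augment_isMFlow (hz : N.IsMFlow z) : N.IsMFlow C.augment := by
  classical
  intro v
  rw [← hz v]
  let p : V → ℤ := fun u => if u = v then 1 else 0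
  have h0 : ∑ a, (if a ∈ Set.range C.edge then p (N.auxHead a) - p (N.auxTail a) else 0) = 0 := by
    rw [sum_ite_mem_range C.edge_injective, Finset.sum_sub_distrib, sub_eq_zero]
    simp only [C.head_eq_tail]
    exact Equiv.sum_comp (Equiv.addRight (1 : Fin (C.n + 1))) fun i => p (N.auxTail (C.edge i))
  rw [Fintype.sum_sum_type, ← Finset.sum_add_distrib] at h0
  rw [← sub_eq_zero, ← h0]
  simp only [Finset.sum_filter, ← Finset.sum_sub_distrib]
  refine Finset.sum_congr rfl fun e _ => ?_
  simp only [augment, auxHead, auxTail, Sum.elim_inl, Sum.elim_inr, p]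
  split_ifs <;> ring

theorem augment_mem_feasibleFlows (hz : z ∈ N.feasibleFlows) : C.augment ∈ N.feasibleFlows := by
  classical
  refine ⟨C.augment_isMFlow hz.1, fun e => ?_⟩
  have hl : Sum.inl e ∈ Set.range C.edge → (z e : WithTop ℤ) < N.upper e := by
    rintro ⟨i, hi⟩
    exact inl_mem_auxEdges.1 (hi ▸ C.edge_mem i)
  have hr : Sum.inr e ∈ Set.range C.edge → N.lower e < (z e : WithBot ℤ) := by
    rintro ⟨i, hi⟩
    exact inr_mem_auxEdges.1 (hi ▸ C.edge_mem i)
  obtain ⟨h1, h2⟩ := hz.2 e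
  simp only [augment]
  constructor
  · cases hb : N.lower e with
    | bot => exact bot_le
    | coe b =>
      rw [hb, WithBot.coe_le_coe] at h1
      rw [hb, WithBot.coe_lt_coe] at hr
      rw [WithBot.coe_le_coe]
      split_ifs with hi hj hj <;> first | omega | (have := hr hj; omega)
  · cases hb : N.upper e with
    | top => exact le_top
    | coe b =>
      rw [hb, WithTop.coe_le_coe] at h2
      rw [hb, WithTop.coe_lt_coe] at hl
      rw [WithTop.coe_le_coe]
      split_ifs with hi hj hj <;> first | omega | (have := hl hi; omega)

theorem isImproving_of_cost_neg (hz : z ∈ N.feasibleFlows)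
    (hneg : ∑ i, toLex (N.cost F z (C.edge i)) < 0) : C.IsImproving F := by
  classical
  refine ⟨C.augment_mem_feasibleFlows hz, ?_⟩
  let K : Fin (N.costDim F z) → ℤ := ∑ i, N.cost F z (C.edge i)
  have hK : toLex K < 0 := hneg
  have hS : 0 ≤ ∑ i, |(K i : ℚ)| := Finset.sum_nonneg fun _ _ => abs_nonneg _
  obtain ⟨B, hB⟩ : ∃ B : ℚ, B = F.card + (∑ i, |(K i : ℚ)|) + 2 := ⟨_, rfl⟩
  have hF0 : (0 : ℚ) ≤ F.card := by positivity
  have hB0 : 0 < B := by linarith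
  have hpr : N.price F z B K < 0 := by
    rw [price_eq]
    exact mul_neg_of_pos_of_neg (by linarith)
      (sum_mul_zpow_neg_of_lex_neg gam_strictAnti hK (by linarith))
  have hle : ∑ e ∈ F, (B ^ C.augment e - B ^ z e) ≤ N.price F z B K := by
    rw [price_sum, ← sum_ite_mem_range C.edge_injective fun a => N.price F z B (N.cost F z a),
      Fintype.sum_sum_type, ← Finset.sum_add_distrib, ← Finset.sum_subset F.subset_univ]
    · refine Finset.sum_le_sum fun e he => ?_
      have hl : Sum.inl e ∈ Set.range C.edge →
          N.price F z B (N.cost F z (Sum.inl e)) = (B - 1) * B ^ z e := by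
        rintro ⟨i, hi⟩
        exact price_cost_inl B (hi ▸ C.edge_mem i) he
      have hr : Sum.inr e ∈ Set.range C.edge →
          N.price F z B (N.cost F z (Sum.inr e)) = -((B - 1) * B ^ (z e - 1)) := by
        rintro ⟨i, hi⟩
        exact price_cost_inr B (hi ▸ C.edge_mem i) he
      have e1 : B ^ (z e + 1) = B * B ^ z e := by rw [add_comm, zpow_one_add₀ hB0.ne']
      have e2 : B ^ z e = B * B ^ (z e - 1) := by
        rw [← zpow_one_add₀ hB0.ne']
        congr 1
        ring
      have hpos : 0 < B ^ (z e - 1) := by positivity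
      simp only [augment]
      split_ifs with h1 h2 h2
      · -- Both copies of `e` are traversed: the flow is unchanged and the price is positive.
        rw [hl h1, hr h2, add_sub_cancel_right, sub_self, e2]
        have : 0 ≤ (B - 1) * (B - 1) * B ^ (z e - 1) :=
          mul_nonneg (mul_self_nonneg _) hpos.le
        linarith
      · rw [hl h1, sub_zero, e1]
        linarith
      · rw [hr h2, add_zero]
        linarith
      · simp
    · intro e _ he
      rw [price_cost_of_base_notMem B (a := Sum.inl e) he,
        price_cost_of_base_notMem B (a := Sum.inr e) he]
      simp
  refine decSmaller_of_sum_zpow_lt (B := B) (by linarith) ?_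
  rw [Finset.sum_sub_distrib] at hle
  linarith

end AuxDiCircuit

theorem exists_isFeasiblePotential (hz : z ∈ N.feasibleFlows)
    (h : ¬ ∃ C : N.AuxDiCircuit z, C.IsImproving F) :
    ∃ π : V → Fin (N.costDim F z) → ℤ, N.IsFeasiblePotential F z π := by
  obtain ⟨π, hπ⟩ := exists_potential_of_circuits_nonneg (tl := N.auxTail) (hd := N.auxHead)
    (S := N.auxEdges z) (fun a => toLex (N.cost F z a)) fun n c hmem hadj hinj => by
      by_contra hneg
      exact h ⟨⟨n, c, hmem, hadj, hinj⟩,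
        AuxDiCircuit.isImproving_of_cost_neg _ hz (not_le.1 hneg)⟩
  exact ⟨fun v => ofLex (π v), hπ⟩

end ModFlowData

theorem mainTheorem2 {V A : Type*} [Fintype V] [Fintype A] (N : ModFlowData V A) (F : Finset A)
    (hF : ∀ e ∈ F, N.lower e ≠ ⊥ ∧ N.upper e ≠ ⊤)
    (z : A → ℤ) (hz : z ∈ N.feasibleFlows) :
    List.TFAE
      [N.IsDecMin F z,
       ¬ ∃ C : N.AuxDiCircuit z, C.IsImproving F,
       N.costDim F z ≤ 2 * F.card ∧
         ∃ π : V → Fin (N.costDim F z) → ℤ, N.IsFeasiblePotential F z π] := by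
  tfae_have 1 → 2 := fun h ⟨C, hC, hlt⟩ => h.2 _ hC hlt
  tfae_have 2 → 3 := fun h => ⟨ModFlowData.costDim_le, ModFlowData.exists_isFeasiblePotential hz h⟩
  tfae_have 3 → 1 := fun ⟨_, _, hπ⟩ => ⟨hz, fun _ hy => hπ.not_decSmaller hz hy⟩
  tfae_finish
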